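/- All graphs $G$ are finite and simple. A planar $3$-graph is a planar graph with maximum degree at most $3$; biconnected means more than two vertices and no cut vertex (and connected); triconnected means simple, with at least four vertices, and connected after deletion of any at most two vertices. The SPQR-tree $T$ of a biconnected graph $G$ is the tree representing the decomposition of $G$ into its triconnected components: each node $\mu$ carries a multigraph $\mathrm{skel}(\mu)$, its skeleton, and is of one of four types: an S-node, if $\mathrm{skel}(\mu)$ is a simple cycle of length at least three; a P-node, if $\mathrm{skel}(\mu)$ is a bundle of at least three parallel edges; an R-node, if $\mathrm{skel}(\mu)$ is a triconnected graph; a Q-node, if $\mu$ is a leaf of $T$, in which case $\mathrm{skel}(\mu)$ consists of two parallel edges, one of which is an edge of $G$ that $\mu$ represents. Each edge of $G$ is represented by exactly one Q-node, and each other skeleton edge of $\mu$ corresponds to exactly one node adjacent to $\mu$ (and conversely). No two S-nodes and no two P-nodes are adjacent, and $G$ is obtained by gluing the skeletons: for each tree edge $\mu\nu$, the end-vertices of the edge of $\mathrm{skel}(\mu)$ corresponding to $\nu$ are identified with those of the edge of $\mathrm{skel}(\nu)$ corresponding to $\mu$. A skeleton edge is real if it is an edge of $G$, i.e. it corresponds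 to a Q-node or is the edge of $G$ in the skeleton of a Q-node; otherwise it is virtual. For an edge $e$ of $G$, the SPQR-tree with respect to the reference edge $e$ is $T$ rooted at the Q-node $\rho$ representing $e$. The child of $\rho$ is the root child; a node is inner if it is neither $\rho$ nor the root child. For $\mu\neq\rho$, the reference edge of $\mathrm{skel}(\mu)$ is the edge corresponding to the parent of $\mu$, and its end-vertices are the poles of $\mu$. **Lemma.** Let $G$ be a biconnected planar $3$-graph and let $T$ be the SPQR-tree of $G$ with respect to a reference edge $e$. Then: * **T1.** Each P-node $\mu$ has exactly two children, one being an S-node and the other being an S-node or a Q-node; if $\mu$ is the root child, both its children are S-nodes. * **T2.** Each child of an R-node is either an S-node or a Q-node. * **T3.** For each inner S-node $\mu$, all edges of $\mathrm{skel}(\mu)$ other than its reference edge that are incident to a pole of $\mu$ are real. Moreover, no two distinct virtual edges of $\mathrm{skel}(\mu)$ are incident to a common vertex. -/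

import Mathlib

open scoped Graph

namespace SPQR

/-! ### Graph connectivity and planarity -/

/-- `G` is `k`-connected: it has more than `k` vertices and deleting fewer than `k` vertices
never disconnects it. -/
def KConnected {α : Type*} (k : ℕ) (G : SimpleGraph α) : Prop :=
  (k : ℕ∞) < ENat.card α ∧ ∀ X : Set α, X.encard < (k : ℕ∞) → (G.induce Xᶜ).Connected

/-- A planar drawing: vertices are distinct points of the plane, edges are simple curves between
the points of their end-vertices, and curves meet each other and the points of the vertices only
at common end-vertices. -/
structure PlanarDrawing {V : Type*} (G : SimpleGraph V) where
  pt : V → EuclideanSpace ℝ (Fin 2)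
  pt_injective : Function.Injective pt
  curve : G.edgeSet → unitInterval → EuclideanSpace ℝ (Fin 2)
  curve_continuous : ∀ e, Continuous (curve e)
  curve_injective : ∀ e, Function.Injective (curve e)
  curve_ends : ∀ e, s(curve e 0, curve e 1) = (e : Sym2 V).map pt
  curve_vertex : ∀ e t v, curve e t = pt v → v ∈ (e : Sym2 V)
  curve_disjoint : ∀ e f, e ≠ f → ∀ s t, curve e s = curve f t →
    ∃ v, v ∈ (e : Sym2 V) ∧ v ∈ (f : Sym2 V) ∧ curve e s = pt v

/-- `G` is planar: it has a planar drawing. -/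
def IsPlanar {V : Type*} (G : SimpleGraph V) : Prop := Nonempty (PlanarDrawing G)

/-! ### The shapes of skeletons -/

/-- The multigraph `H` is a simple cycle of length at least three. -/
def IsSimpleCycle {α β : Type*} (H : Graph α β) : Prop :=
  ∃ n : ℕ, 3 ≤ n ∧ ∃ (v : ZMod n → α) (f : ZMod n → β),
    Function.Injective v ∧ Function.Injective f ∧
    V(H) = Set.range v ∧ E(H) = Set.range f ∧ ∀ i, H.IsLink (f i) (v i) (v (i + 1))

/-- The multigraph `H` consists of two distinct vertices and of parallel edges joining them. -/
def IsBundle {α β : Type*} (H : Graph α β) : Prop :=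
  ∃ u v : α, u ≠ v ∧ V(H) = {u, v} ∧ ∀ f ∈ E(H), H.IsLink f u v

/-- The multigraph `H` is a triconnected (simple) graph. -/
def IsTriconnected {α β : Type*} (H : Graph α β) : Prop :=
  H.Simple ∧ KConnected 3 H.toSimpleGraph

/-! ### SPQR-trees -/

/-- Names of the edges in the skeleton of a node of a tree with node set `N`: `toNode ν` is the
skeleton edge that corresponds to the adjacent tree node `ν`, and `graphEdge` is the edge, present
only in the skeletons of Q-nodes, that stands for the edge of the graph represented by the node. -/
inductive SkelEdge (N : Type*) where
  | graphEdge : SkelEdge N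
  | toNode (ν : N) : SkelEdge N

/-- Type Q: the skeleton consists of two parallel edges, one of which stands for an edge of the
represented graph. -/
def IsQSkel {V N : Type*} (H : Graph V (SkelEdge N)) : Prop :=
  IsBundle H ∧ E(H).encard = 2 ∧ SkelEdge.graphEdge ∈ E(H)

/-- Type S: the skeleton is a simple cycle of length at least three. -/
def IsSSkel {V N : Type*} (H : Graph V (SkelEdge N)) : Prop :=
  IsSimpleCycle H ∧ SkelEdge.graphEdge ∉ E(H)

/-- Type P: the skeleton is a bundle of at least three parallel edges. -/
def IsPSkel {V N : Type*} (H : Graph V (SkelEdge N)) : Prop :=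
  IsBundle H ∧ 3 ≤ E(H).encard ∧ SkelEdge.graphEdge ∉ E(H)

/-- Type R: the skeleton is a triconnected graph. -/
def IsRSkel {V N : Type*} (H : Graph V (SkelEdge N)) : Prop :=
  IsTriconnected H ∧ SkelEdge.graphEdge ∉ E(H)

/-- `SPQRTree G N`: an (unrooted) SPQR-tree of `G` with node set `N`, that is, the decomposition
of `G` into its triconnected components.  The vertices of all skeletons are named by the vertices
of `G` that they stand for. -/
structure SPQRTree {V : Type*} (G : SimpleGraph V) (N : Type*) where
  tree : SimpleGraph N
  finite_nodes : Finite N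
  isTree : tree.IsTree
  /-- The skeleton of a node. -/
  skel : N → Graph V (SkelEdge N)
  /-- Every node is an S-, P-, Q- or R-node. -/
  node_type : ∀ μ, IsSSkel (skel μ) ∨ IsPSkel (skel μ) ∨ IsQSkel (skel μ) ∨ IsRSkel (skel μ)
  /-- No two S-nodes are adjacent. -/
  not_adj_S : ∀ μ ν, tree.Adj μ ν → ¬ (IsSSkel (skel μ) ∧ IsSSkel (skel ν))
  /-- No two P-nodes are adjacent. -/
  not_adj_P : ∀ μ ν, tree.Adj μ ν → ¬ (IsPSkel (skel μ) ∧ IsPSkel (skel ν))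
  /-- The skeleton of `μ` has one edge for each node adjacent to `μ`. -/
  toNode_mem : ∀ μ ν, SkelEdge.toNode ν ∈ E(skel μ) ↔ tree.Adj μ ν
  /-- Corresponding edges in the skeletons of adjacent nodes have the same end-vertices. -/
  toNode_ends : ∀ μ ν, tree.Adj μ ν → ∀ x y,
    (skel μ).IsLink (.toNode ν) x y ↔ (skel ν).IsLink (.toNode μ) x y
  /-- Q-nodes represent edges of `G`. -/
  graphEdge_adj : ∀ μ x y, (skel μ).IsLink .graphEdge x y → G.Adj x y
  /-- Every edge of `G` is represented by exactly one Q-node. -/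
  existsUnique_graphEdge : ∀ x y, G.Adj x y → ∃! μ, (skel μ).IsLink .graphEdge x y
  /-- The vertices of `G` arise from those of the skeletons exactly by identifying the end-vertices
  of corresponding skeleton edges: skeletons of adjacent nodes share only these end-vertices, ... -/
  mem_inter : ∀ μ ν, tree.Adj μ ν → ∀ x, x ∈ V(skel μ) → x ∈ V(skel ν) →
    (skel μ).Inc (.toNode ν) x
  /-- ... and the nodes whose skeleton contains a given vertex of `G` form a subtree. -/
  connected_nodes : ∀ x, (tree.induce {μ | x ∈ V(skel μ)}).Connected

namespace SPQRTree

variable {V : Type*} {G : SimpleGraph V} {N : Type*} (T : SPQRTree G N)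

def IsSNode (μ : N) : Prop := IsSSkel (T.skel μ)

def IsPNode (μ : N) : Prop := IsPSkel (T.skel μ)

def IsQNode (μ : N) : Prop := IsQSkel (T.skel μ)

def IsRNode (μ : N) : Prop := IsRSkel (T.skel μ)

/-- `ρ` is the Q-node that represents the edge `e` of `G`; rooting `T` at this node gives the
SPQR-tree of `G` with respect to the reference edge `e`. -/
def Represents (ρ : N) (e : Sym2 V) : Prop :=
  T.IsQNode ρ ∧ ∃ x y, e = s(x, y) ∧ (T.skel ρ).IsLink .graphEdge x y

/-- In `T` rooted at `ρ`, the node `ν` is a child of `μ` (and `μ` is the parent of `ν`). -/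
def IsChild (ρ ν μ : N) : Prop :=
  T.tree.Adj μ ν ∧ T.tree.dist ρ ν = T.tree.dist ρ μ + 1

/-- The root child is the child of the root. -/
def IsRootChild (ρ μ : N) : Prop := T.IsChild ρ μ ρ

/-- An inner node is neither the root nor the root child. -/
def IsInner (ρ μ : N) : Prop := μ ≠ ρ ∧ ¬ T.IsRootChild ρ μ

/-- The reference edge of the skeleton of `μ` is the skeleton edge that corresponds to the parent
of `μ`. -/
def IsReferenceEdge (ρ μ : N) (f : SkelEdge N) : Prop :=
  ∃ π, T.IsChild ρ μ π ∧ f = .toNode π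

/-- The poles of `μ` are the end-vertices of the reference edge of its skeleton. -/
def IsPole (ρ μ : N) (x : V) : Prop :=
  ∃ f, T.IsReferenceEdge ρ μ f ∧ (T.skel μ).Inc f x

/-- A skeleton edge is real if it is an edge of `G`, that is, if it corresponds to a Q-node (or is
the edge of `G` in the skeleton of a Q-node). -/
def IsReal (μ : N) (f : SkelEdge N) : Prop :=
  f ∈ E(T.skel μ) ∧ (f = .graphEdge ∨ ∃ ν, T.IsQNode ν ∧ f = .toNode ν)

/-- The skeleton edges that are not real are virtual. -/
def IsVirtual (μ : N) (f : SkelEdge N) : Prop :=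
  f ∈ E(T.skel μ) ∧ ¬ T.IsReal μ f

end SPQRTree

end SPQR

/-!
Fix a vertex `x` of `G`. The nodes of the SPQR-tree whose skeleton contains `x` induce a subtree, and
the degree of a node in this subtree is the number of its skeleton edges at `x` that correspond to
other nodes (`encard_neighborSet_induce`). That number is at least `1` for a Q-node, at
least `2` for an S-node and at least `3` for a P- or R-node. The Q-nodes of the subtree stand for
distinct edges of `G` at `x` (`card_qNodes_le_degree`), so there are at most three of them.

In a finite tree the sum of `degree - 2` is `-2`. Hence the sum of `degree - 2` over the nodes of
the subtree other than Q-nodes is at most `3 - 2 = 1`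
(`SimpleGraph.IsTree.sum_degree_sub_two_add_two_le`). So `x` lies in the skeleton of at most one P-
or R-node (`eq_of_isPNode_or_isRNode`), and such a node has exactly three skeleton edges at `x`
(`ncard_incNodes_le_three`).

The claims are read off at a common vertex of adjacent skeletons. Neighbours of P- and R-nodes are
S- or Q-nodes, which settles the children of R-nodes. A P-node has three neighbours, of which at
most one is a Q-node, because two would represent the same edge; this gives its two children. The
parent of an inner S-node, and the node of any virtual edge of an S-node, is a P- or R-node, and no
vertex belongs to the skeletons of two of these.
-/

/-! ### Counting leaves in a finite tree -/

namespace SimpleGraph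

/-- If all vertices of degree one of a finite tree lie in `Q`, then the branching outside `Q` is
bounded by the size of `Q`. The truncated subtraction is exact since degrees outside `Q` are at
least two. -/
lemma IsTree.sum_degree_sub_two_add_two_le {V : Type*} [Fintype V] [DecidableEq V]
    {G : SimpleGraph V} [DecidableRel G.Adj] (hG : G.IsTree) (Q : Finset V)
    (h₁ : ∀ v ∈ Q, 1 ≤ G.degree v) (h₂ : ∀ v ∉ Q, 2 ≤ G.degree v) :
    ∑ v ∈ Qᶜ, (G.degree v - 2) + 2 ≤ Q.card := by
  have hE := hG.card_edgeFinset
  have hS := G.sum_degrees_eq_twice_card_edges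
  have hsplit := Finset.sum_add_sum_compl Q fun v ↦ G.degree v
  have hQ : Q.card ≤ ∑ v ∈ Q, G.degree v := by
    simpa using Finset.card_nsmul_le_sum Q (fun v ↦ G.degree v) 1 h₁
  have hQc : ∑ v ∈ Qᶜ, G.degree v = ∑ v ∈ Qᶜ, (G.degree v - 2) + 2 * Qᶜ.card := by
    rw [mul_comm, ← smul_eq_mul, ← Finset.sum_const, ← Finset.sum_add_distrib]
    refine Finset.sum_congr rfl fun v hv ↦ ?_
    have := h₂ v (by simpa using hv)
    omega
  have hc := Q.card_add_card_compl
  omega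

/-- In a rooted tree, a node has at most one parent. -/
lemma IsTree.eq_of_adj_of_dist_eq {V : Type*} {G : SimpleGraph V} (hG : G.IsTree) {r u v w : V}
    (hv : G.Adj v u) (hw : G.Adj w u) (hdv : G.dist r u = G.dist r v + 1)
    (hdw : G.dist r u = G.dist r w + 1) : v = w := by
  obtain ⟨p, -, hp⟩ := hG.connected.exists_path_of_dist r v
  obtain ⟨q, -, hq⟩ := hG.connected.exists_path_of_dist r w
  have hp' : (p.concat hv).IsPath := Walk.isPath_of_length_eq_dist _ (by simp [hp, hdv])
  have hq' : (q.concat hw).IsPath := Walk.isPath_of_length_eq_dist _ (by simp [hq, hdw])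
  have h := (hG.existsUnique_path r u).unique hp' hq'
  simpa using congrArg Walk.penultimate h

/-- In a rooted tree, every node other than the root has a parent. -/
lemma Connected.exists_adj_dist_eq {V : Type*} {G : SimpleGraph V} (hG : G.Connected) {r u : V}
    (h : u ≠ r) : ∃ v, G.Adj v u ∧ G.dist r u = G.dist r v + 1 := by
  obtain ⟨p, hpath, hp⟩ := hG.exists_path_of_dist r u
  have hnil : ¬ p.Nil := fun hn ↦ h hn.eq.symm
  have hadj := p.adj_penultimate hnil
  refine ⟨p.penultimate, hadj, ?_⟩
  have h₁ := dist_le p.dropLast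
  have h₂ : G.dist r u ≤ G.dist r p.penultimate + 1 := by
    have := hG.dist_triangle (u := r) (v := p.penultimate) (w := u)
    rwa [dist_eq_one_iff_adj.2 hadj] at this
  have h₃ : 0 < p.length := Walk.not_nil_iff_lt_length.1 hnil
  simp at h₁
  omega

end SimpleGraph

namespace SPQR

/-! ### Vertex degrees in skeletons -/

lemma KConnected.le_encard_neighborSet {α : Type*} {k : ℕ} {G : SimpleGraph α}
    (h : KConnected k G) (x : α) : (k : ℕ∞) ≤ (G.neighborSet x).encard := by
  by_contra! hlt
  have hconn := h.2 _ hlt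
  -- deleting the neighbours of `x` isolates `x`, but leaves a further vertex `y`
  obtain ⟨y, hy⟩ : ∃ y, y ∉ insert x (G.neighborSet x) := by
    by_contra! hall
    have huniv : insert x (G.neighborSet x) = Set.univ := Set.eq_univ_of_forall hall
    have h₁ := Set.encard_insert_le (G.neighborSet x) x
    rw [huniv, Set.encard_univ] at h₁
    have h₂ := h₁.trans (Order.add_one_le_of_lt hlt)
    exact absurd h.1 (not_lt.2 h₂)
  rw [Set.mem_insert_iff, not_or] at hy
  let x' : ((G.neighborSet x)ᶜ : Set α) := ⟨x, by simp⟩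
  have : Nontrivial ((G.neighborSet x)ᶜ : Set α) :=
    ⟨x', ⟨y, hy.2⟩, fun h ↦ hy.1 (congrArg Subtype.val h).symm⟩
  obtain ⟨z, hz⟩ := hconn.preconnected.exists_adj_of_nontrivial x'
  exact z.2 hz

lemma IsSimpleCycle.two_le_encard_incidenceSet {α β : Type*} {H : Graph α β}
    (hH : IsSimpleCycle H) {x : α} (hx : x ∈ V(H)) : 2 ≤ (H.incidenceSet x).encard := by
  obtain ⟨n, hn, v, f, -, hf, hV, -, hlink⟩ := hH
  rw [hV] at hx
  obtain ⟨i, rfl⟩ := hx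
  have : Fact (1 < n) := ⟨by omega⟩
  have hne : f i ≠ f (i - 1) := fun h ↦ one_ne_zero (sub_eq_self.1 (hf h).symm)
  rw [← Set.encard_pair hne]
  refine Set.encard_le_encard (Set.insert_subset (hlink i).inc_left (Set.singleton_subset_iff.2 ?_))
  have := (hlink (i - 1)).inc_right
  rwa [sub_add_cancel] at this

lemma IsBundle.inc {α β : Type*} {H : Graph α β} (hH : IsBundle H) {x : α} (hx : x ∈ V(H))
    {f : β} (hf : f ∈ E(H)) : H.Inc f x := by
  obtain ⟨u, v, -, hV, hlink⟩ := hH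
  rw [hV] at hx
  rcases hx with rfl | rfl
  · exact (hlink f hf).inc_left
  · exact (hlink f hf).inc_right

lemma IsBundle.incidenceSet_eq {α β : Type*} {H : Graph α β} (hH : IsBundle H) {x : α}
    (hx : x ∈ V(H)) : H.incidenceSet x = E(H) :=
  Set.Subset.antisymm (H.incidenceSet_subset_edgeSet x) fun _ hf ↦ hH.inc hx hf

lemma IsTriconnected.three_le_encard_incidenceSet {α β : Type*} {H : Graph α β}
    (hH : IsTriconnected H) {x : α} (hx : x ∈ V(H)) : 3 ≤ (H.incidenceSet x).encard := by
  refine (hH.2.le_encard_neighborSet ⟨x, hx⟩).trans ?_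
  have h : ∀ y : H.toSimpleGraph.neighborSet ⟨x, hx⟩, ∃ f, H.IsLink f x y :=
    fun y ↦ y.2.2
  choose f hf using h
  refine Function.Embedding.encard_le
    ⟨fun y ↦ (⟨f y, (hf y).inc_left⟩ : H.incidenceSet x), fun y z hyz ↦ ?_⟩
  have hyz : f y = f z := congrArg Subtype.val hyz
  exact Subtype.ext (Subtype.ext ((hf y).right_unique (hyz ▸ hf z)))

namespace SPQRTree

/-! ### The subtree of the nodes that contain a given vertex -/

variable {V : Type*} {G : SimpleGraph V} {N : Type*} (T : SPQRTree G N)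

/-- The neighbours of the node `μ` whose skeleton edges in `skel μ` are incident to `x`. -/
def incNodes (μ : N) (x : V) : Set N := {ν | (T.skel μ).Inc (.toNode ν) x}

variable {T}

lemma adj_of_inc {μ ν : N} {x : V} (h : (T.skel μ).Inc (.toNode ν) x) : T.tree.Adj μ ν :=
  (T.toNode_mem μ ν).1 h.edge_mem

lemma inc_symm {μ ν : N} {x : V} (h : (T.skel μ).Inc (.toNode ν) x) :
    (T.skel ν).Inc (.toNode μ) x := by
  obtain ⟨y, hy⟩ := h
  exact ⟨y, (T.toNode_ends μ ν (adj_of_inc ⟨y, hy⟩) x y).1 hy⟩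

/-- The degree of a node in the subtree of the nodes containing `x` is the number of its skeleton
edges at `x` that correspond to other nodes. -/
lemma encard_neighborSet_induce {μ : N} {x : V} (hx : x ∈ V(T.skel μ)) :
    ((T.tree.induce {μ | x ∈ V(T.skel μ)}).neighborSet ⟨μ, hx⟩).encard =
      (T.incNodes μ x).encard := by
  rw [← Subtype.val_injective.encard_image]
  congr 1
  ext ν
  simp only [Set.mem_image, SimpleGraph.mem_neighborSet, SimpleGraph.comap_adj, incNodes,
    Set.mem_ofPred_eq, Subtype.exists, exists_and_right, exists_eq_right]
  exact ⟨fun ⟨h, hadj⟩ ↦ T.mem_inter μ ν hadj x hx h,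
    fun h ↦ ⟨(inc_symm h).vertex_mem, adj_of_inc h⟩⟩

lemma toNode_injective : Function.Injective (SkelEdge.toNode : N → SkelEdge N) :=
  fun _ _ h ↦ SkelEdge.toNode.inj h

lemma exists_eq_toNode {μ : N} (h : SkelEdge.graphEdge ∉ E(T.skel μ)) {f : SkelEdge N}
    (hf : f ∈ E(T.skel μ)) : ∃ ν, f = .toNode ν := by
  cases f with
  | graphEdge => exact absurd hf h
  | toNode ν => exact ⟨ν, rfl⟩

lemma encard_incNodes {μ : N} (h : SkelEdge.graphEdge ∉ E(T.skel μ)) (x : V) :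
    (T.incNodes μ x).encard = ((T.skel μ).incidenceSet x).encard := by
  rw [← toNode_injective.encard_image]
  congr 1
  ext f
  constructor
  · rintro ⟨ν, hν, rfl⟩
    exact hν
  · intro hf
    obtain ⟨ν, rfl⟩ := exists_eq_toNode h (Graph.Inc.edge_mem hf)
    exact ⟨ν, hf, rfl⟩

lemma three_le_encard_incNodes {μ : N} {x : V} (hμ : T.IsPNode μ ∨ T.IsRNode μ)
    (hx : x ∈ V(T.skel μ)) : 3 ≤ (T.incNodes μ x).encard := by
  obtain h | h := hμ
  · rw [encard_incNodes h.2.2, h.1.incidenceSet_eq hx]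
    exact h.2.1
  · rw [encard_incNodes h.2]
    exact h.1.three_le_encard_incidenceSet hx

lemma two_le_encard_incNodes {μ : N} {x : V} (hμ : ¬ T.IsQNode μ) (hx : x ∈ V(T.skel μ)) :
    2 ≤ (T.incNodes μ x).encard := by
  obtain h | h | h | h := T.node_type μ
  · rw [encard_incNodes h.2]
    exact h.1.two_le_encard_incidenceSet hx
  · exact le_trans (by norm_num) (three_le_encard_incNodes (.inl h) hx)
  · exact absurd h hμ
  · exact le_trans (by norm_num) (three_le_encard_incNodes (.inr h) hx)

/-- A Q-node is a leaf of the tree. -/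
lemma IsQNode.exists_forall_adj_iff {μ : N} (hμ : T.IsQNode μ) :
    ∃ ν, ∀ ν', T.tree.Adj μ ν' ↔ ν' = ν := by
  obtain ⟨-, h₂, hg⟩ := hμ
  obtain ⟨f, g, hfg, hE⟩ := Set.encard_eq_two.1 h₂
  have key : ∃ ν, E(T.skel μ) = {.graphEdge, .toNode ν} := by
    rw [hE] at hg ⊢
    obtain rfl | hg := hg
    · cases g with
      | graphEdge => exact absurd rfl hfg
      | toNode ν => exact ⟨ν, rfl⟩
    · obtain rfl := Set.mem_singleton_iff.1 hg
      cases f with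
      | graphEdge => exact absurd rfl hfg
      | toNode ν => exact ⟨ν, Set.pair_comm _ _⟩
  obtain ⟨ν, hν⟩ := key
  refine ⟨ν, fun ν' ↦ ?_⟩
  rw [← T.toNode_mem, hν]
  simp

lemma one_le_encard_incNodes {μ : N} {x : V} (hx : x ∈ V(T.skel μ)) :
    1 ≤ (T.incNodes μ x).encard := by
  by_cases hμ : T.IsQNode μ
  · obtain ⟨ν, hν⟩ := hμ.exists_forall_adj_iff
    exact Set.one_le_encard_iff_nonempty.2
      ⟨ν, hμ.1.inc hx ((T.toNode_mem μ ν).2 ((hν ν).2 rfl))⟩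
  · exact le_trans (by norm_num) (two_le_encard_incNodes hμ hx)

/-- Distinct Q-nodes containing `x` represent distinct edges of `G` at `x`. -/
lemma card_qNodes_le_degree [Fintype V] [DecidableRel G.Adj] (x : V)
    (Q : Finset {μ | x ∈ V(T.skel μ)}) (hQ : ∀ μ ∈ Q, T.IsQNode μ) : Q.card ≤ G.degree x := by
  have h : ∀ μ : {μ | x ∈ V(T.skel μ)}, ∃ y, μ ∈ Q → (T.skel μ).IsLink .graphEdge x y := by
    intro μ
    by_cases hμ : μ ∈ Q
    · obtain ⟨y, hy⟩ := (hQ μ hμ).1.inc μ.2 (hQ μ hμ).2.2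
      exact ⟨y, fun _ ↦ hy⟩
    · exact ⟨x, fun h ↦ absurd h hμ⟩
  choose y hy using h
  rw [← G.card_neighborFinset_eq_degree]
  refine Finset.card_le_card_of_injOn y (fun μ hμ ↦ ?_) fun μ hμ ν hν hyy ↦ ?_
  · simpa using T.graphEdge_adj _ _ _ (hy μ hμ)
  · have h₁ := hy μ hμ
    have h₂ := hy ν hν
    rw [← hyy] at h₂
    exact Subtype.ext ((T.existsUnique_graphEdge _ _ (T.graphEdge_adj _ _ _ h₁)).unique h₁ h₂)

/-- The leaf count in the subtree of the nodes containing `x`: any finite family of such nodes other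
than Q-nodes has total branching at most one. -/
lemma sum_ncard_incNodes_sub_two_le_one [Fintype V] [DecidableRel G.Adj] (hdeg : G.maxDegree ≤ 3)
    (x : V) (s : Finset {μ | x ∈ V(T.skel μ)}) (hs : ∀ μ ∈ s, ¬ T.IsQNode μ) :
    ∑ μ ∈ s, ((T.incNodes μ x).ncard - 2) ≤ 1 := by
  classical
  have := T.finite_nodes
  have := Fintype.ofFinite {μ | x ∈ V(T.skel μ)}
  have htree : (T.tree.induce {μ | x ∈ V(T.skel μ)}).IsTree :=
    ⟨T.connected_nodes x, T.isTree.isAcyclic.induce _⟩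
  have hd : ∀ μ : {μ | x ∈ V(T.skel μ)},
      ((T.tree.induce {μ | x ∈ V(T.skel μ)}).degree μ : ℕ∞) = (T.incNodes μ x).encard := by
    intro μ
    rw [← encard_neighborSet_induce μ.2, ← SimpleGraph.card_neighborSet_eq_degree,
      Set.encard_eq_coe_toFinset_card, Set.toFinset_card]
  have hd' : ∀ μ : {μ | x ∈ V(T.skel μ)},
      (T.tree.induce {μ | x ∈ V(T.skel μ)}).degree μ = (T.incNodes μ x).ncard := by
    intro μ
    rw [Set.ncard_def, ← hd, ENat.toNat_natCast]
  let Q : Finset {μ | x ∈ V(T.skel μ)} := {μ | T.IsQNode μ}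
  have hmem : ∀ μ, μ ∈ Q ↔ T.IsQNode μ := fun μ ↦ by simp [Q]
  have hle := htree.sum_degree_sub_two_add_two_le Q
    (fun μ _ ↦ by exact_mod_cast (hd μ).symm ▸ one_le_encard_incNodes μ.2)
    (fun μ hμ ↦ by
      exact_mod_cast (hd μ).symm ▸ two_le_encard_incNodes (fun h ↦ hμ ((hmem μ).2 h)) μ.2)
  have hcard := card_qNodes_le_degree x Q fun μ hμ ↦ (hmem μ).1 hμ
  have hx := (G.degree_le_maxDegree x).trans hdeg
  have hsub : s ⊆ Qᶜ := fun μ hμ ↦ by simpa [hmem] using hs μ hμ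
  have hsum := Finset.sum_le_sum_of_subset
    (f := fun μ : {μ | x ∈ V(T.skel μ)} ↦ (T.incNodes μ x).ncard - 2) hsub
  simp only [hd'] at hle
  omega

/-! ### Consequences of the degree bound -/

lemma not_isQNode {μ : N} (h : T.IsPNode μ ∨ T.IsRNode μ) : ¬ T.IsQNode μ := by
  rintro ⟨-, -, hg⟩
  obtain h | h := h
  · exact h.2.2 hg
  · exact h.2 hg

lemma three_le_ncard_incNodes {μ : N} {x : V} (hμ : T.IsPNode μ ∨ T.IsRNode μ)
    (hx : x ∈ V(T.skel μ)) : 3 ≤ (T.incNodes μ x).ncard := by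
  have := T.finite_nodes
  have h := three_le_encard_incNodes hμ hx
  rw [← Set.Finite.cast_ncard_eq (Set.toFinite _)] at h
  exact_mod_cast h

lemma ncard_incNodes_le_three [Fintype V] [DecidableRel G.Adj] (hdeg : G.maxDegree ≤ 3) {μ : N}
    {x : V} (hμ : T.IsPNode μ ∨ T.IsRNode μ) (hx : x ∈ V(T.skel μ)) :
    (T.incNodes μ x).ncard ≤ 3 := by
  have h := sum_ncard_incNodes_sub_two_le_one (T := T) hdeg x {⟨μ, hx⟩}
    (by simpa using not_isQNode hμ)
  rw [Finset.sum_singleton] at h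
  have h : (T.incNodes μ x).ncard - 2 ≤ 1 := h
  omega

/-- A vertex of a `3`-graph lies in the skeleton of at most one P- or R-node. -/
lemma eq_of_isPNode_or_isRNode [Fintype V] [DecidableRel G.Adj] (hdeg : G.maxDegree ≤ 3) {μ ν : N}
    {x : V} (hμ : T.IsPNode μ ∨ T.IsRNode μ) (hν : T.IsPNode ν ∨ T.IsRNode ν)
    (hxμ : x ∈ V(T.skel μ)) (hxν : x ∈ V(T.skel ν)) : μ = ν := by
  classical
  by_contra hne
  have hne' : (⟨μ, hxμ⟩ : {μ | x ∈ V(T.skel μ)}) ≠ ⟨ν, hxν⟩ :=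
    fun h ↦ hne (congrArg Subtype.val h)
  have h := sum_ncard_incNodes_sub_two_le_one (T := T) hdeg x {⟨μ, hxμ⟩, ⟨ν, hxν⟩}
    (by simpa using ⟨not_isQNode hμ, not_isQNode hν⟩)
  rw [Finset.sum_pair hne'] at h
  have h : ((T.incNodes μ x).ncard - 2) + ((T.incNodes ν x).ncard - 2) ≤ 1 := h
  have := three_le_ncard_incNodes hμ hxμ
  have := three_le_ncard_incNodes hν hxν
  omega

lemma isSNode_or_isQNode_of_adj [Fintype V] [DecidableRel G.Adj] (hdeg : G.maxDegree ≤ 3)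
    {μ ν : N} (hμ : T.IsPNode μ ∨ T.IsRNode μ) (h : T.tree.Adj μ ν) :
    T.IsSNode ν ∨ T.IsQNode ν := by
  obtain ⟨x, y, hxy⟩ := Graph.exists_isLink_of_mem_edgeSet ((T.toNode_mem μ ν).2 h)
  have hν : ¬ (T.IsPNode ν ∨ T.IsRNode ν) := fun hν ↦
    h.ne (eq_of_isPNode_or_isRNode hdeg hμ hν hxy.inc_left.vertex_mem
      (inc_symm hxy.inc_left).vertex_mem)
  obtain hS | hP | hQ | hR := T.node_type ν
  · exact .inl hS
  · exact absurd (.inl hP) hν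
  · exact .inr hQ
  · exact absurd (.inr hR) hν

lemma isPNode_or_isRNode_of_adj {μ ν : N} (hμ : T.IsSNode μ) (hν : ¬ T.IsQNode ν)
    (h : T.tree.Adj μ ν) : T.IsPNode ν ∨ T.IsRNode ν := by
  obtain hS | hP | hQ | hR := T.node_type ν
  · exact absurd ⟨hμ, hS⟩ (T.not_adj_S μ ν h)
  · exact .inl hP
  · exact absurd hQ hν
  · exact .inr hR

/-- At most one virtual edge of the skeleton of an S-node is incident to a given vertex `x`. -/
lemma eq_of_inc_of_not_isQNode [Fintype V] [DecidableRel G.Adj] (hdeg : G.maxDegree ≤ 3)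
    {μ ν ν' : N} {x : V} (hμ : T.IsSNode μ) (hν : ¬ T.IsQNode ν) (hν' : ¬ T.IsQNode ν')
    (h : (T.skel μ).Inc (.toNode ν) x) (h' : (T.skel μ).Inc (.toNode ν') x) : ν = ν' :=
  eq_of_isPNode_or_isRNode hdeg (isPNode_or_isRNode_of_adj hμ hν (adj_of_inc h))
    (isPNode_or_isRNode_of_adj hμ hν' (adj_of_inc h'))
    (inc_symm h).vertex_mem (inc_symm h').vertex_mem

/-- At most one neighbour of a P-node is a Q-node, because two of them would represent the same edge
of `G`. -/
lemma IsPNode.eq_of_isQNode {μ ν ν' : N} (hμ : T.IsPNode μ) (hν : T.IsQNode ν)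
    (hν' : T.IsQNode ν') (h : T.tree.Adj μ ν) (h' : T.tree.Adj μ ν') : ν = ν' := by
  obtain ⟨u, v, huv, -, hlink⟩ := hμ.1
  have key : ∀ κ, T.IsQNode κ → T.tree.Adj μ κ → (T.skel κ).IsLink .graphEdge u v := by
    intro κ hκ hadj
    have hl := (T.toNode_ends μ κ hadj u v).1 (hlink _ ((T.toNode_mem μ κ).2 hadj))
    obtain ⟨a, b, -, -, hab⟩ := hκ.1
    have h₁ := hab _ hl.edge_mem
    have h₂ := hab _ hκ.2.2
    rw [h₂.isLink_iff]
    exact h₁.isLink_iff.1 hl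
  exact (T.existsUnique_graphEdge u v (T.graphEdge_adj _ _ _ (key ν hν h))).unique
    (key ν hν h) (key ν' hν' h')

lemma IsPNode.ncard_neighborSet [Fintype V] [DecidableRel G.Adj] (hdeg : G.maxDegree ≤ 3) {μ : N}
    (hμ : T.IsPNode μ) : (T.tree.neighborSet μ).ncard = 3 := by
  obtain ⟨u, v, -, hV, -⟩ := id hμ.1
  have hu : u ∈ V(T.skel μ) := by simp [hV]
  have heq : T.tree.neighborSet μ = T.incNodes μ u := by
    ext ν
    exact ⟨fun h ↦ hμ.1.inc hu ((T.toNode_mem μ ν).2 h), adj_of_inc⟩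
  rw [heq]
  exact le_antisymm (ncard_incNodes_le_three hdeg (.inl hμ) hu)
    (three_le_ncard_incNodes (.inl hμ) hu)

/-! ### Parents and children -/

lemma isChild_iff_ne_of_isChild {ρ μ π : N} (hπ : T.IsChild ρ μ π) (ν : N) :
    T.IsChild ρ ν μ ↔ T.tree.Adj μ ν ∧ ν ≠ π := by
  refine ⟨fun h ↦ ⟨h.1, ?_⟩, fun ⟨hadj, hne⟩ ↦ ⟨hadj, ?_⟩⟩
  · rintro rfl
    have h₁ := h.2
    have h₂ := hπ.2
    omega
  · obtain h | h := T.isTree.dist_eq_dist_add_one_of_adj ρ hadj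
    · exact absurd (T.isTree.eq_of_adj_of_dist_eq hadj.symm hπ.1 h hπ.2) hne
    · exact h

/-- A Q-node has a child only if it is the root. -/
lemma IsChild.not_isQNode {ρ μ π : N} (h : T.IsChild ρ μ π) (hπ : π ≠ ρ) : ¬ T.IsQNode π := by
  intro hQ
  obtain ⟨κ, hκ⟩ := hQ.exists_forall_adj_iff
  obtain ⟨σ, hσ, hdσ⟩ := T.isTree.connected.exists_adj_dist_eq hπ
  obtain rfl := (hκ μ).1 h.1
  obtain rfl := (hκ σ).1 hσ.symm
  have := h.2
  omega

lemma IsPNode.exists_children [Fintype V] [DecidableRel G.Adj] (hdeg : G.maxDegree ≤ 3) {ρ μ : N}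
    (hρ : T.IsQNode ρ) (hμ : T.IsPNode μ) :
    ∃ ν₁ ν₂, ν₁ ≠ ν₂ ∧ (∀ ν, T.IsChild ρ ν μ ↔ ν = ν₁ ∨ ν = ν₂) ∧
      T.IsSNode ν₁ ∧ (T.IsSNode ν₂ ∨ T.IsQNode ν₂) := by
  have := T.finite_nodes
  have hne : μ ≠ ρ := by
    rintro rfl
    exact T.not_isQNode (.inl hμ) hρ
  obtain ⟨π, hπ⟩ := T.isTree.connected.exists_adj_dist_eq hne
  have hcard : (T.tree.neighborSet μ \ {π}).ncard = 2 := by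
    have hmem : π ∈ T.tree.neighborSet μ := hπ.1.symm
    rw [Set.ncard_sdiff_singleton_of_mem hmem, hμ.ncard_neighborSet hdeg]
  obtain ⟨a, b, hab, hset⟩ := Set.ncard_eq_two.1 hcard
  have hchild : ∀ ν, T.IsChild ρ ν μ ↔ ν = a ∨ ν = b := by
    intro ν
    rw [isChild_iff_ne_of_isChild hπ]
    exact Set.ext_iff.1 hset ν
  have ha := ((hchild a).2 (.inl rfl)).1
  have hb := ((hchild b).2 (.inr rfl)).1
  have hb' := isSNode_or_isQNode_of_adj hdeg (.inl hμ) hb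
  obtain haS | haQ := isSNode_or_isQNode_of_adj hdeg (.inl hμ) ha
  · exact ⟨a, b, hab, hchild, haS, hb'⟩
  · obtain hbS | hbQ := hb'
    · exact ⟨b, a, hab.symm, fun ν ↦ (hchild ν).trans or_comm, hbS, .inr haQ⟩
    · exact absurd (hμ.eq_of_isQNode haQ hbQ ha hb) hab

end SPQRTree

end SPQR

theorem mainTheorem10 {V : Type*} [Fintype V] (G : SimpleGraph V) [DecidableRel G.Adj]
    (hbiconn : SPQR.KConnected 2 G) (hplanar : SPQR.IsPlanar G) (hdeg : G.maxDegree ≤ 3)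
    {N : Type*} (T : SPQR.SPQRTree G N) (e : Sym2 V) (ρ : N) (hρ : T.Represents ρ e) :
    -- T1
    (∀ μ, T.IsPNode μ →
      (∃ ν₁ ν₂, ν₁ ≠ ν₂ ∧ (∀ ν, T.IsChild ρ ν μ ↔ ν = ν₁ ∨ ν = ν₂) ∧
        T.IsSNode ν₁ ∧ (T.IsSNode ν₂ ∨ T.IsQNode ν₂)) ∧
      (T.IsRootChild ρ μ → ∀ ν, T.IsChild ρ ν μ → T.IsSNode ν)) ∧
    -- T2
    (∀ μ, T.IsRNode μ → ∀ ν, T.IsChild ρ ν μ → T.IsSNode ν ∨ T.IsQNode ν) ∧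
    -- T3
    (∀ μ, T.IsSNode μ → T.IsInner ρ μ →
      (∀ f x, f ∈ E(T.skel μ) → ¬ T.IsReferenceEdge ρ μ f → T.IsPole ρ μ x →
        (T.skel μ).Inc f x → T.IsReal μ f) ∧
      (∀ f g x, T.IsVirtual μ f → T.IsVirtual μ g → f ≠ g →
        (T.skel μ).Inc f x → ¬ (T.skel μ).Inc g x)) := by
  refine ⟨fun μ hμ ↦ ⟨hμ.exists_children hdeg hρ.1, fun hroot ν hν ↦ ?_⟩,
    fun μ hμ ν hν ↦ SPQR.SPQRTree.isSNode_or_isQNode_of_adj hdeg (.inr hμ) hν.1,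
    fun μ hμ hinner ↦ ⟨?_, ?_⟩⟩
  · obtain hS | hQ := SPQR.SPQRTree.isSNode_or_isQNode_of_adj hdeg (.inl hμ) hν.1
    · exact hS
    · exact absurd (hμ.eq_of_isQNode hQ hρ.1 hν.1 hroot.1.symm)
        ((SPQR.SPQRTree.isChild_iff_ne_of_isChild hroot ν).1 hν).2
  · rintro f x hf hnref ⟨_, ⟨π, hπ, rfl⟩, hx⟩ hfx
    obtain ⟨ν, rfl⟩ := SPQR.SPQRTree.exists_eq_toNode hμ.2 hf
    refine ⟨hf, .inr ⟨ν, ?_, rfl⟩⟩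
    by_contra hν
    have hπρ : π ≠ ρ := by
      rintro rfl
      exact hinner.2 hπ
    obtain rfl := SPQR.SPQRTree.eq_of_inc_of_not_isQNode hdeg hμ hν (hπ.not_isQNode hπρ) hfx hx
    exact hnref ⟨ν, hπ, rfl⟩
  · intro f g x hf hg hfg hfx hgx
    obtain ⟨ν, rfl⟩ := SPQR.SPQRTree.exists_eq_toNode hμ.2 hf.1
    obtain ⟨ν', rfl⟩ := SPQR.SPQRTree.exists_eq_toNode hμ.2 hg.1
    have hν : ¬ T.IsQNode ν := fun h ↦ hf.2 ⟨hf.1, .inr ⟨ν, h, rfl⟩⟩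
    have hν' : ¬ T.IsQNode ν' := fun h ↦ hg.2 ⟨hg.1, .inr ⟨ν', h, rfl⟩⟩
    exact hfg (congrArg _ (SPQR.SPQRTree.eq_of_inc_of_not_isQNode hdeg hμ hν hν' hfx hgx))
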